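/- Let $p>1$ and let $\overline M$ be a compact smooth Riemannian manifold with boundary $\partial M$ and interior $M$, with metric $g$, Riemannian volume $dv_g$, and gradient $\nabla$. Consider the Dirichlet eigenvalue problem for the $p$-Laplacian $$-\Delta_p\varphi=\lambda|\varphi|^{p-2}\varphi \ \text{ on } M,\qquad \varphi=0\ \text{ on }\partial M ,$$ understood weakly: $\varphi\in W^{1,p}_0(M)$, $\varphi\not\equiv 0$, and $$\int_M|\nabla\varphi|^{p-2}\,\nabla\varphi\cdot\nabla v\,dv_g=\lambda\int_M|\varphi|^{p-2}\varphi\,v\,dv_g\qquad\text{for all } v\in C^1_0(M),$$ where $W^{1,p}_0(M)$ is the closure of $C_0^\infty(M)$ in the norm $\left(\int_M|u|^p\,dv_g+\int_M|\nabla u|^p\,dv_g\right)^{1/p}$. Let $\lambda_1$ be the smallest $\lambda$ for which this problem has a solution, and let $\varphi_1$ be a solution for $\lambda=\lambda_1$. Assume that $\varphi_1\in C^1(\overline M)$, that $\varphi_1=0$ on $\partial M$, that $\varphi_1>0$ on $M$, and that $|\nabla\varphi_1|\neq 0$ on $\partial M$. Put $d(x)=\operatorname{dist}(x,\partial M)$,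 the Riemannian distance to the boundary. Then there exists a constant $c>0$ such that $$c\int_M\frac{|u|^p}{d^p}\,dv_g\le\int_M|\nabla u|^p\,dv_g\qquad\text{for all } u\in C_0^\infty(M).$$ -/

import Mathlib

open scoped Manifold ContDiff Topology ENNReal
open MeasureTheory Bundle

noncomputable section

namespace HardyManifold

section Volume

variable (n : ℕ) [NeZero n] {M : Type*} [TopologicalSpace M] [ChartedSpace (EuclideanHalfSpace n) M]
  [RiemannianBundle (fun x : M => TangentSpace (𝓡∂ n) x)]

/-- The `i`-th coordinate vector field `∂ᵢ` of the chart centred at `c`, at the point with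
coordinates `y`. -/
def coordVector (c : M) (y : EuclideanSpace ℝ (Fin n)) (i : Fin n) :
    TangentSpace (𝓡∂ n) ((extChartAt (𝓡∂ n) c).symm y) :=
  mfderivWithin 𝓘(ℝ, EuclideanSpace ℝ (Fin n)) (𝓡∂ n) (extChartAt (𝓡∂ n) c).symm
    (Set.range (𝓡∂ n)) y (EuclideanSpace.single i (1 : ℝ))

/-- The matrix `g_ij = g(∂ᵢ, ∂ⱼ)` of the Riemannian metric in the chart centred at `c`. -/
def metricMatrix (c : M) (y : EuclideanSpace ℝ (Fin n)) : Matrix (Fin n) (Fin n) ℝ :=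
  Matrix.of fun i j => inner ℝ (coordVector n c y i) (coordVector n c y j)

variable [MeasurableSpace M]

/-- The measure `√(det g_ij) dy` of the chart centred at `c`, carried over to the manifold. It is
the Riemannian volume restricted to the domain of that chart. -/
def chartVolume (c : M) : Measure M :=
  ((volume.restrict (extChartAt (𝓡∂ n) c).target).withDensity
    (fun y => ENNReal.ofReal (Real.sqrt (metricMatrix n c y).det))).map
      (extChartAt (𝓡∂ n) c).symm

theorem chartVolume_apply [BorelSpace M] (c : M) {s : Set M} (hs : MeasurableSet s) :
    chartVolume n c s =
      ∫⁻ y in (extChartAt (𝓡∂ n) c).target ∩ (extChartAt (𝓡∂ n) c).symm ⁻¹' s,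
        ENNReal.ofReal (Real.sqrt (metricMatrix n c y).det) := by
  have ht : MeasurableSet (extChartAt (𝓡∂ n) c).target := by
    rw [extChartAt_target]
    exact (((chartAt _ c).open_target.preimage (𝓡∂ n).continuous_symm).measurableSet).inter
      (𝓡∂ n).isClosed_range.measurableSet
  have hm : AEMeasurable (extChartAt (𝓡∂ n) c).symm
      (volume.restrict (extChartAt (𝓡∂ n) c).target) :=
    (continuousOn_extChartAt_symm c).aemeasurable ht
  have hm' := hm.mono_ac (withDensity_absolutelyContinuous _
    (fun y => ENNReal.ofReal (Real.sqrt (metricMatrix n c y).det)))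
  have hn : NullMeasurableSet ((extChartAt (𝓡∂ n) c).symm ⁻¹' s)
      (volume.restrict (extChartAt (𝓡∂ n) c).target) := hm.nullMeasurableSet_preimage hs
  rw [chartVolume, Measure.map_apply_of_aemeasurable hm' hs, withDensity_apply' ,
    Measure.restrict_restrict₀ hn, Set.inter_comm]

/-- The Riemannian volume measure `dv_g`. The measures of the charts agree where the charts
overlap, and their supremum is the measure obtained by gluing them. -/
def riemannianVolume : Measure M :=
  ⨆ c : M, chartVolume n c

end Volume

section Functions

variable (n : ℕ) [NeZero n] {M : Type*} [TopologicalSpace M] [ChartedSpace (EuclideanHalfSpace n) M]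

/-- `u` belongs to `C^k_0` of the interior of the manifold: it is of class `C^k`, and its support
is a compact subset of the interior. -/
def IsTest (k : ℕ∞) (u : M → ℝ) : Prop :=
  ContMDiff (𝓡∂ n) 𝓘(ℝ, ℝ) k u ∧ HasCompactSupport u ∧ tsupport u ⊆ (𝓡∂ n).interior M

variable [RiemannianBundle (fun x : M => TangentSpace (𝓡∂ n) x)]

/-- The Riemannian gradient `∇ u` of a function: the vector that represents the differential of
`u` with respect to the metric. -/
def grad (u : M → ℝ) (x : M) : TangentSpace (𝓡∂ n) x :=
  haveI : FiniteDimensional ℝ (TangentSpace (𝓡∂ n) x) :=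
    inferInstanceAs (FiniteDimensional ℝ (EuclideanSpace ℝ (Fin n)))
  haveI : CompleteSpace (TangentSpace (𝓡∂ n) x) := FiniteDimensional.complete ℝ _
  (InnerProductSpace.toDual ℝ (TangentSpace (𝓡∂ n) x)).symm (mfderiv (𝓡∂ n) 𝓘(ℝ, ℝ) u x)

theorem inner_grad (u : M → ℝ) (x : M) (v : TangentSpace (𝓡∂ n) x) :
    inner ℝ (grad n u x) v = mfderiv (𝓡∂ n) 𝓘(ℝ, ℝ) u x v := by
  have : FiniteDimensional ℝ (TangentSpace (𝓡∂ n) x) :=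
    inferInstanceAs (FiniteDimensional ℝ (EuclideanSpace ℝ (Fin n)))
  have : CompleteSpace (TangentSpace (𝓡∂ n) x) := FiniteDimensional.complete ℝ _
  exact InnerProductSpace.toDual_symm_apply

end Functions

section Eigenvalues

variable (n : ℕ) [NeZero n] {M : Type*} [TopologicalSpace M] [ChartedSpace (EuclideanHalfSpace n) M]
  [IsManifold (𝓡∂ n) ∞ M] [RiemannianBundle (fun x : M => TangentSpace (𝓡∂ n) x)]
  [MeasurableSpace M]

/-- `f` belongs to `W^{1,p}_0` of the interior of the manifold, with weak gradient `G`. This space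
is the closure of the smooth functions with compact support in the norm
`(∫ |f|^p + ∫ |∇ f|^p)^{1/p}`. -/
def MemW0 (p : ℝ) (f : M → ℝ) (G : ∀ x : M, TangentSpace (𝓡∂ n) x) : Prop :=
  AEStronglyMeasurable f ((riemannianVolume n).restrict ((𝓡∂ n).interior M)) ∧
  AEStronglyMeasurable (fun x => (⟨x, G x⟩ : TangentBundle (𝓡∂ n) M))
    ((riemannianVolume n).restrict ((𝓡∂ n).interior M)) ∧
  ∃ u : ℕ → M → ℝ, (∀ k, IsTest n ⊤ (u k)) ∧
    Filter.Tendsto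
      (fun k => ∫⁻ x in (𝓡∂ n).interior M,
        ENNReal.ofReal (|u k x - f x| ^ p + ‖grad n (u k) x - G x‖ ^ p) ∂riemannianVolume n)
      Filter.atTop (𝓝 0)

/-- `f`, with weak gradient `G`, is an eigenfunction with eigenvalue `lam` of the Dirichlet problem
`-Δ_p f = lam |f|^{p-2} f` in the interior, `f = 0` on the boundary. The equation holds weakly,
that is, when tested with `C^1_0` functions. -/
def IsDirichletEigenpair (p lam : ℝ) (f : M → ℝ) (G : ∀ x : M, TangentSpace (𝓡∂ n) x) : Prop :=
  MemW0 n p f G ∧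
  ¬ f =ᵐ[(riemannianVolume n).restrict ((𝓡∂ n).interior M)] 0 ∧
  ∀ v : M → ℝ, IsTest n 1 v →
    ∫ x in (𝓡∂ n).interior M, ‖G x‖ ^ (p - 2) * inner ℝ (G x) (grad n v x) ∂riemannianVolume n =
      lam * ∫ x in (𝓡∂ n).interior M, |f x| ^ (p - 2) * f x * v x ∂riemannianVolume n

/-- The function `φ` of class `C^1` up to the boundary is a first eigenfunction of the Dirichlet
`p`-Laplacian: it vanishes on the boundary, and it is an eigenfunction for the smallest of all
eigenvalues. -/
def IsFirstEigenfunction (p : ℝ) (φ : M → ℝ) : Prop :=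
  ContMDiff (𝓡∂ n) 𝓘(ℝ, ℝ) 1 φ ∧
  (∀ x ∈ (𝓡∂ n).boundary M, φ x = 0) ∧
  ∃ lam : ℝ, IsDirichletEigenpair n p lam φ (grad n φ) ∧
    ∀ (lam' : ℝ) (f : M → ℝ) (G : ∀ x : M, TangentSpace (𝓡∂ n) x),
      IsDirichletEigenpair n p lam' f G → lam ≤ lam'

end Eigenvalues

end HardyManifold

end

/-! Picone's argument. Let `u` be a test function and put `h = u / φ`. Testing the eigenvalue
equation with `|h|^p φ = |u|^p φ^{1-p}` and absorbing half of the `|h|^p |∇φ|^p` term by Young's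
inequality gives `∫ |h|^p ((p-1)/2 |∇φ|^p + λ φ^p) ≤ C ∫ |∇u|^p` (`IsDirichletEigenpair.picone`).
The weight on the left is continuous and positive on a compact space, because `φ > 0` inside and `∇φ
≠ 0` on the boundary, so it has a lower bound `m > 0`. Moreover `φ` is `K`-Lipschitz for the
Riemannian distance and vanishes on the boundary (`enorm_sub_le_mul_riemannianEDist`), so `φ ≤ K d`
and `|u| / d ≤ K |h|`. Hence `c = m / (C K^p)`.

Positivity of the weight needs `λ > 0` (`IsDirichletEigenpair.pos`). Testing with functions that
approximate `φ` in `W^{1,p}` shows that `λ ≤ 0` would force `∇φ = 0` almost everywhere, hence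
everywhere by continuity, against `∇φ ≠ 0` on the boundary.

The argument uses three geometric facts: inner products of gradients of `C^1` functions are
continuous, the Riemannian volume of a compact manifold is finite, and every nonempty open set meets
the interior in positive volume. They are proved in charts. -/

noncomputable section

namespace HardyManifold

/-! ### Coordinate vector fields and the gradient in a chart -/

section Charts

variable (n : ℕ) [NeZero n] {M : Type*} [TopologicalSpace M] [ChartedSpace (EuclideanHalfSpace n) M]

theorem mfderivWithin_extChartAt_symm_apply (c : M) (y v : EuclideanSpace ℝ (Fin n)) :
    mfderivWithin 𝓘(ℝ, EuclideanSpace ℝ (Fin n)) (𝓡∂ n) (extChartAt (𝓡∂ n) c).symm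
      (Set.range (𝓡∂ n)) y v = ∑ i, v i • coordVector n c y i := by
  let D : EuclideanSpace ℝ (Fin n) →L[ℝ] TangentSpace (𝓡∂ n) ((extChartAt (𝓡∂ n) c).symm y) :=
    mfderivWithin 𝓘(ℝ, EuclideanSpace ℝ (Fin n)) (𝓡∂ n) (extChartAt (𝓡∂ n) c).symm
      (Set.range (𝓡∂ n)) y
  have hv : v = ∑ i, v i • EuclideanSpace.single i (1 : ℝ) := by
    ext j
    simp [Finset.sum_apply, Pi.single_apply]
  calc D v = D (∑ i, v i • EuclideanSpace.single i (1 : ℝ)) := by rw [← hv]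
    _ = ∑ i, v i • D (EuclideanSpace.single i (1 : ℝ)) := by simp only [map_sum, map_smul]

variable [IsManifold (𝓡∂ n) ∞ M]

/-- The tangent map of a `C^1` map is continuous. It is taken within the target of the chart, where
the derivative agrees with the one within the whole half-space. -/
theorem continuousOn_extChartAt_symm_tangent (c : M) (v : EuclideanSpace ℝ (Fin n)) :
    ContinuousOn (fun y => (⟨(extChartAt (𝓡∂ n) c).symm y,
      mfderivWithin 𝓘(ℝ, EuclideanSpace ℝ (Fin n)) (𝓡∂ n) (extChartAt (𝓡∂ n) c).symm
        (Set.range (𝓡∂ n)) y v⟩ : TangentBundle (𝓡∂ n) M)) (extChartAt (𝓡∂ n) c).target := by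
  have hsub := extChartAt_target_subset_range (I := 𝓡∂ n) c
  have hu : UniqueMDiffOn 𝓘(ℝ, EuclideanSpace ℝ (Fin n)) (extChartAt (𝓡∂ n) c).target :=
    by
    rw [uniqueMDiffOn_iff_uniqueDiffOn]; exact uniqueDiffOn_extChartAt_target c
  have h1 : ContMDiffOn 𝓘(ℝ, EuclideanSpace ℝ (Fin n)) (𝓡∂ n) 1 (extChartAt (𝓡∂ n) c).symm
      (extChartAt (𝓡∂ n) c).target :=
    (contMDiffOn_extChartAt_symm (n := ∞) c).of_le (by simp)
  have h2 := h1.continuousOn_tangentMapWithin le_rfl hu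
  have h3 : ContinuousOn (fun y : EuclideanSpace ℝ (Fin n) =>
      (⟨y, v⟩ : TangentBundle 𝓘(ℝ, EuclideanSpace ℝ (Fin n)) (EuclideanSpace ℝ (Fin n))))
      (extChartAt (𝓡∂ n) c).target :=
    ((tangentBundleModelSpaceHomeomorph 𝓘(ℝ, EuclideanSpace ℝ (Fin n))).symm.continuous.comp
      (continuous_id.prodMk continuous_const)).continuousOn
  refine (h2.comp h3 fun y hy => hy).congr fun y hy => ?_
  have : mfderivWithin 𝓘(ℝ, EuclideanSpace ℝ (Fin n)) (𝓡∂ n) (extChartAt (𝓡∂ n) c).symm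
      (extChartAt (𝓡∂ n) c).target y =
      mfderivWithin 𝓘(ℝ, EuclideanSpace ℝ (Fin n)) (𝓡∂ n) (extChartAt (𝓡∂ n) c).symm
      (Set.range (𝓡∂ n)) y :=
    (mdifferentiableWithinAt_extChartAt_symm hy).mfderivWithin_mono (hu y hy) hsub
  simp only [tangentMapWithin, Function.comp_apply, this]

theorem continuousOn_coordVector (c : M) (i : Fin n) :
    ContinuousOn (fun y => (⟨(extChartAt (𝓡∂ n) c).symm y, coordVector n c y i⟩ :
      TangentBundle (𝓡∂ n) M)) (extChartAt (𝓡∂ n) c).target :=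
  continuousOn_extChartAt_symm_tangent n c _

theorem exists_eq_sum_coordVector {c : M} {y : EuclideanSpace ℝ (Fin n)}
    (hy : y ∈ (extChartAt (𝓡∂ n) c).target)
    (w : TangentSpace (𝓡∂ n) ((extChartAt (𝓡∂ n) c).symm y)) :
    ∃ v : Fin n → ℝ, w = ∑ i, v i • coordVector n c y i := by
  obtain ⟨v, hv⟩ := (isInvertible_mfderivWithin_extChartAt_symm hy).bijective.2 w
  exact ⟨(show EuclideanSpace ℝ (Fin n) from v).ofLp,
    hv.symm.trans (mfderivWithin_extChartAt_symm_apply n c y v)⟩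

theorem linearIndependent_coordVector {c : M} {y : EuclideanSpace ℝ (Fin n)}
    (hy : y ∈ (extChartAt (𝓡∂ n) c).target) : LinearIndependent ℝ (coordVector n c y) := by
  rw [Fintype.linearIndependent_iff]
  intro g hg i
  have h := (mfderivWithin_extChartAt_symm_apply n c y (WithLp.toLp 2 g)).trans hg
  have h0 : (WithLp.toLp 2 g : EuclideanSpace ℝ (Fin n)) = 0 :=
    (isInvertible_mfderivWithin_extChartAt_symm hy).bijective.1 (h.trans (map_zero _).symm)
  simpa using congrArg (fun z : EuclideanSpace ℝ (Fin n) => z i) h0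

/-- The partial derivative `∂ᵢ f` in the chart centred at `c`, at the point with coordinates `y`. -/
def coordDeriv (f : M → ℝ) (c : M) (y : EuclideanSpace ℝ (Fin n)) (i : Fin n) : ℝ :=
  mfderiv (𝓡∂ n) 𝓘(ℝ, ℝ) f ((extChartAt (𝓡∂ n) c).symm y) (coordVector n c y i)

theorem continuousOn_coordDeriv {f : M → ℝ} (hf : ContMDiff (𝓡∂ n) 𝓘(ℝ, ℝ) 1 f) (c : M) :
    ContinuousOn (coordDeriv n f c) (extChartAt (𝓡∂ n) c).target := by
  refine continuousOn_pi.2 fun i => ?_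
  have h1 := (hf.continuous_tangentMap le_rfl).comp_continuousOn (continuousOn_coordVector n c i)
  exact (contMDiff_snd_tangentBundle_modelSpace ℝ 𝓘(ℝ, ℝ) (n := 0)).continuous.comp_continuousOn h1

variable [RiemannianBundle (fun x : M => TangentSpace (𝓡∂ n) x)]

theorem metricMatrix_posDef {c : M} {y : EuclideanSpace ℝ (Fin n)}
    (hy : y ∈ (extChartAt (𝓡∂ n) c).target) : (metricMatrix n c y).PosDef :=
  Matrix.posDef_gram_of_linearIndependent (𝕜 := ℝ) (linearIndependent_coordVector n hy)

/-- The formula `∇f = g^{ij} ∂ᵢf ∂ⱼ`: both sides have the same inner product with each coordinate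
vector, and these vectors span. -/
theorem grad_eq_sum_coordVector (f : M → ℝ) {c : M} {y : EuclideanSpace ℝ (Fin n)}
    (hy : y ∈ (extChartAt (𝓡∂ n) c).target) :
    grad n f ((extChartAt (𝓡∂ n) c).symm y) =
      ∑ j, ((metricMatrix n c y)⁻¹.mulVec (coordDeriv n f c y)) j • coordVector n c y j := by
  set a := (metricMatrix n c y)⁻¹.mulVec (coordDeriv n f c y) with ha
  have hG : (metricMatrix n c y).mulVec a = coordDeriv n f c y := by
    rw [ha, Matrix.mulVec_mulVec, Matrix.mul_nonsing_inv _
      (Ne.isUnit (metricMatrix_posDef n hy).det_pos.ne'), Matrix.one_mulVec]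
  have hX : ∀ i, inner ℝ (coordVector n c y i) (grad n f ((extChartAt (𝓡∂ n) c).symm y) -
      ∑ j, a j • coordVector n c y j) = 0 := by
    intro i
    have h1 : inner ℝ (coordVector n c y i) (grad n f ((extChartAt (𝓡∂ n) c).symm y)) =
        coordDeriv n f c y i := by
      rw [real_inner_comm]
      exact inner_grad n f _ _
    rw [inner_sub_right, h1, inner_sum, ← hG, sub_eq_zero]
    simp only [inner_smul_right, Matrix.mulVec, dotProduct]
    exact Finset.sum_congr rfl fun j _ => mul_comm _ _
  obtain ⟨v, hv⟩ := exists_eq_sum_coordVector n hy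
    (grad n f ((extChartAt (𝓡∂ n) c).symm y) - ∑ j, a j • coordVector n c y j)
  rw [← sub_eq_zero, ← inner_self_eq_zero (𝕜 := ℝ)]
  nth_rw 1 [hv]
  rw [sum_inner]
  refine Finset.sum_eq_zero fun i _ => ?_
  rw [inner_smul_left, hX, mul_zero]

theorem inner_grad_extChartAt_symm (f h : M → ℝ) {c : M} {y : EuclideanSpace ℝ (Fin n)}
    (hy : y ∈ (extChartAt (𝓡∂ n) c).target) :
    inner ℝ (grad n f ((extChartAt (𝓡∂ n) c).symm y)) (grad n h ((extChartAt (𝓡∂ n) c).symm y)) =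
      ((metricMatrix n c y)⁻¹.mulVec (coordDeriv n h c y)) ⬝ᵥ coordDeriv n f c y := by
  nth_rw 1 [grad_eq_sum_coordVector n h hy]
  rw [inner_sum]
  exact Finset.sum_congr rfl fun j _ => by rw [inner_smul_right, inner_grad]; rfl

variable [IsContMDiffRiemannianBundle (𝓡∂ n) ∞ (EuclideanSpace ℝ (Fin n))
      (fun x : M => TangentSpace (𝓡∂ n) x)]

theorem isContinuousRiemannianBundle_tangentSpace : IsContinuousRiemannianBundle
    (EuclideanSpace ℝ (Fin n)) (fun x : M => TangentSpace (𝓡∂ n) x) := by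
  obtain ⟨g, hg, hg'⟩ := IsContMDiffRiemannianBundle.exists_contMDiff (IB := 𝓡∂ n) (n := ∞)
    (F := EuclideanSpace ℝ (Fin n)) (E := fun x : M => TangentSpace (𝓡∂ n) x)
  exact ⟨g, hg.continuous, hg'⟩

theorem continuousOn_metricMatrix (c : M) :
    ContinuousOn (metricMatrix n c) (extChartAt (𝓡∂ n) c).target := by
  have := isContinuousRiemannianBundle_tangentSpace n (M := M)
  refine continuousOn_pi.2 fun i => continuousOn_pi.2 fun j => ?_
  exact (continuousOn_coordVector n c i).inner_bundle (continuousOn_coordVector n c j)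

theorem continuousOn_sqrt_det_metricMatrix (c : M) :
    ContinuousOn (fun y => Real.sqrt (metricMatrix n c y).det) (extChartAt (𝓡∂ n) c).target :=
  Real.continuous_sqrt.comp_continuousOn
    ((continuous_id.matrix_det).comp_continuousOn (continuousOn_metricMatrix n c))

/-- The gradient is defined fibre by fibre through Riesz representation, which does not show
continuity. In a chart the product is `g^{ij} ∂ᵢf ∂ⱼh`, and inversion of the metric matrix is
continuous where its determinant is nonzero. -/
theorem continuous_inner_grad {f h : M → ℝ} (hf : ContMDiff (𝓡∂ n) 𝓘(ℝ, ℝ) 1 f)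
    (hh : ContMDiff (𝓡∂ n) 𝓘(ℝ, ℝ) 1 h) :
    Continuous fun x => (inner ℝ (grad n f x) (grad n h x) : ℝ) := by
  have key : ∀ c : M, ContinuousOn (fun y : EuclideanSpace ℝ (Fin n) =>
      (inner ℝ (grad n f ((extChartAt (𝓡∂ n) c).symm y))
        (grad n h ((extChartAt (𝓡∂ n) c).symm y)) : ℝ)) (extChartAt (𝓡∂ n) c).target := by
    intro c
    have hinv : ContinuousOn (fun y => (metricMatrix n c y)⁻¹) (extChartAt (𝓡∂ n) c).target := by
      intro y hy
      refine ContinuousAt.comp_continuousWithinAt (g := fun A : Matrix (Fin n) (Fin n) ℝ => A⁻¹)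
        ?_ (continuousOn_metricMatrix n c y hy)
      refine continuousAt_matrix_inv _ ?_
      rw [Ring.inverse_eq_inv']
      exact continuousAt_inv₀ (metricMatrix_posDef n hy).det_pos.ne'
    have hm : ContinuousOn (fun y => (metricMatrix n c y)⁻¹.mulVec (coordDeriv n h c y))
        (extChartAt (𝓡∂ n) c).target :=
      (Continuous.matrix_mulVec continuous_fst continuous_snd).comp_continuousOn
        (hinv.prodMk (continuousOn_coordDeriv n hh c))
    have hs : ContinuousOn (fun y => ((metricMatrix n c y)⁻¹.mulVec (coordDeriv n h c y)) ⬝ᵥ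
        coordDeriv n f c y) (extChartAt (𝓡∂ n) c).target :=
      (Continuous.dotProduct continuous_fst continuous_snd).comp_continuousOn
        (hm.prodMk (continuousOn_coordDeriv n hf c))
    intro y hy
    exact (hs y hy).congr (fun z hz => inner_grad_extChartAt_symm n f h hz)
      (inner_grad_extChartAt_symm n f h hy)
  refine continuous_iff_continuousAt.2 fun x => ?_
  have h1 : ContinuousAt (fun z => (inner ℝ
      (grad n f ((extChartAt (𝓡∂ n) x).symm (extChartAt (𝓡∂ n) x z)))
      (grad n h ((extChartAt (𝓡∂ n) x).symm (extChartAt (𝓡∂ n) x z))) : ℝ)) x := by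
    have h2 := ((key x).comp (continuousOn_extChartAt x) (extChartAt (𝓡∂ n) x).mapsTo)
    exact h2.continuousAt (extChartAt_source_mem_nhds x)
  refine h1.congr ?_
  filter_upwards [extChartAt_source_mem_nhds (I := 𝓡∂ n) x] with z hz
  rw [(extChartAt (𝓡∂ n) x).left_inv hz]

theorem continuous_norm_grad {f : M → ℝ} (hf : ContMDiff (𝓡∂ n) 𝓘(ℝ, ℝ) 1 f) :
    Continuous fun x => ‖grad n f x‖ := by
  simp only [norm_eq_sqrt_real_inner]
  exact (continuous_inner_grad n hf hf).sqrt

end Charts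

/-! ### Compatibility, finiteness and positivity of the Riemannian volume -/

section Volume

variable (n : ℕ) [NeZero n] {M : Type*} [TopologicalSpace M] [ChartedSpace (EuclideanHalfSpace n) M]

/-- The coordinate change from the chart centred at `c` to the chart centred at `c'`. -/
def transition (c c' : M) : EuclideanSpace ℝ (Fin n) → EuclideanSpace ℝ (Fin n) :=
  extChartAt (𝓡∂ n) c' ∘ (extChartAt (𝓡∂ n) c).symm

/-- All tangent spaces share the model space as underlying type, but the inner product depends on
the base point. This moves it between two expressions of one point in different charts. -/
theorem inner_congr_basepoint [RiemannianBundle (fun x : M => TangentSpace (𝓡∂ n) x)]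
    {x x' : M} (h : x = x') (v w : EuclideanSpace ℝ (Fin n)) :
    (inner ℝ (show TangentSpace (𝓡∂ n) x from v) (show TangentSpace (𝓡∂ n) x from w) : ℝ) =
    inner ℝ (show TangentSpace (𝓡∂ n) x' from v) (show TangentSpace (𝓡∂ n) x' from w) := by
  subst h
  rfl

variable [IsManifold (𝓡∂ n) ∞ M]

theorem differentiableWithinAt_transition {c c' : M} {y : EuclideanSpace ℝ (Fin n)}
    (hy : y ∈ (extChartAt (𝓡∂ n) c).target)
    (hy' : (extChartAt (𝓡∂ n) c).symm y ∈ (extChartAt (𝓡∂ n) c').source) :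
    DifferentiableWithinAt ℝ (transition n c c') (Set.range (𝓡∂ n)) y :=
  (contDiffWithinAt_ext_coord_change (n := ∞) c' c (by
    rw [PartialEquiv.trans_source]; exact ⟨hy, hy'⟩)).differentiableWithinAt (by simp)

/-- The chain rule, since near `y` the inverse of the first chart is the inverse of the second
composed with the transition. The equation lives in the model space because the two sides are based
at different expressions of the same point. -/
theorem coordVector_eq_sum_transition {c c' : M} {y : EuclideanSpace ℝ (Fin n)}
    (hy : y ∈ (extChartAt (𝓡∂ n) c).target)
    (hy' : (extChartAt (𝓡∂ n) c).symm y ∈ (extChartAt (𝓡∂ n) c').source) (i : Fin n) :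
    (coordVector n c y i : EuclideanSpace ℝ (Fin n)) =
      ∑ j, (fderivWithin ℝ (transition n c c') (Set.range (𝓡∂ n)) y
        (EuclideanSpace.single i (1 : ℝ))) j • coordVector n c' (transition n c c' y) j := by
  have hr := extChartAt_target_subset_range (I := 𝓡∂ n) c hy
  have hU : UniqueMDiffWithinAt 𝓘(ℝ, EuclideanSpace ℝ (Fin n)) (Set.range (𝓡∂ n)) y :=
    (𝓡∂ n).uniqueMDiffOn _ hr
  have hτ : transition n c c' y ∈ (extChartAt (𝓡∂ n) c').target :=
    (extChartAt (𝓡∂ n) c').map_source hy'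
  have hcomp := mfderivWithin_comp y (I := 𝓘(ℝ, EuclideanSpace ℝ (Fin n)))
    (I' := 𝓘(ℝ, EuclideanSpace ℝ (Fin n))) (I'' := 𝓡∂ n)
    (f := transition n c c') (g := (extChartAt (𝓡∂ n) c').symm) (s := Set.range (𝓡∂ n))
    (u := Set.range (𝓡∂ n))
    (mdifferentiableWithinAt_extChartAt_symm hτ)
    (differentiableWithinAt_transition n hy hy').mdifferentiableWithinAt
    (fun z _ => Set.mem_range_self _) hU
  have hev : (extChartAt (𝓡∂ n) c).symm =ᶠ[𝓝[Set.range (𝓡∂ n)] y]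
      (extChartAt (𝓡∂ n) c').symm ∘ transition n c c' := by
    have h1 := extChartAt_target_mem_nhdsWithin_of_mem hy
    have h2 : (extChartAt (𝓡∂ n) c).symm ⁻¹' (extChartAt (𝓡∂ n) c').source ∈
        𝓝[Set.range (𝓡∂ n)] y :=
      (mdifferentiableWithinAt_extChartAt_symm hy).continuousWithinAt.preimage_mem_nhdsWithin
        ((isOpen_extChartAt_source c').mem_nhds hy')
    filter_upwards [h1, h2] with z _ hz2
    exact ((extChartAt (𝓡∂ n) c').left_inv hz2).symm
  have heq := hev.mfderivWithin_eq (I := 𝓘(ℝ, EuclideanSpace ℝ (Fin n))) (I' := 𝓡∂ n)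
    (hev.self_of_nhdsWithin hr)
  have h3 := mfderivWithin_extChartAt_symm_apply n c' (transition n c c' y)
    (fderivWithin ℝ (transition n c c') (Set.range (𝓡∂ n)) y (EuclideanSpace.single i (1 : ℝ)))
  refine Eq.trans ?_ h3
  rw [← mfderivWithin_eq_fderivWithin]
  exact DFunLike.congr_fun (heq.trans hcomp) (EuclideanSpace.single i (1 : ℝ))

variable [RiemannianBundle (fun x : M => TangentSpace (𝓡∂ n) x)]

/-- With `J` the Jacobian matrix of the transition, the metric matrices satisfy `G = Jᵀ G' J`, so
`det G = (det J)² det G'`. -/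
theorem sqrt_det_metricMatrix_transition {c c' : M} {y : EuclideanSpace ℝ (Fin n)}
    (hy : y ∈ (extChartAt (𝓡∂ n) c).target)
    (hy' : (extChartAt (𝓡∂ n) c).symm y ∈ (extChartAt (𝓡∂ n) c').source) :
    Real.sqrt (metricMatrix n c y).det =
      |(fderivWithin ℝ (transition n c c') (Set.range (𝓡∂ n)) y).det| *
        Real.sqrt (metricMatrix n c' (transition n c c' y)).det := by
  set D := fderivWithin ℝ (transition n c c') (Set.range (𝓡∂ n)) y with hD
  set b := (EuclideanSpace.basisFun (Fin n) ℝ).toBasis with hb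
  set J := LinearMap.toMatrix b b (D : EuclideanSpace ℝ (Fin n) →ₗ[ℝ] EuclideanSpace ℝ (Fin n))
    with hJ
  have hJa : ∀ i j, J i j = D (EuclideanSpace.single j (1 : ℝ)) i := by
    intro i j
    simp [hJ, LinearMap.toMatrix_apply, hb]
  have hG : metricMatrix n c y = J.transpose * metricMatrix n c' (transition n c c' y) * J := by
    ext i j
    have hx : (extChartAt (𝓡∂ n) c).symm y =
        (extChartAt (𝓡∂ n) c').symm (transition n c c' y) :=
      ((extChartAt (𝓡∂ n) c').left_inv hy').symm
    have h1 : metricMatrix n c y i j =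
        inner ℝ (∑ k, J k i • coordVector n c' (transition n c c' y) k)
          (∑ k, J k j • coordVector n c' (transition n c c' y) k) := by
      simp only [hJa]
      have e1 := coordVector_eq_sum_transition n hy hy' i
      have e2 := coordVector_eq_sum_transition n hy hy' j
      have := inner_congr_basepoint n hx (coordVector n c y i) (coordVector n c y j)
      refine this.trans ?_
      exact congrArg₂ (fun v w : TangentSpace (𝓡∂ n)
        ((extChartAt (𝓡∂ n) c').symm (transition n c c' y)) => (inner ℝ v w : ℝ)) e1 e2
    rw [h1, sum_inner, Matrix.mul_assoc, Matrix.mul_apply]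
    refine Finset.sum_congr rfl fun k _ => ?_
    rw [inner_sum, Matrix.transpose_apply, Matrix.mul_apply, Finset.mul_sum]
    refine Finset.sum_congr rfl fun l _ => ?_
    rw [inner_smul_left, inner_smul_right, mul_comm (J l j)]
    rfl
  have hdet : J.det = D.det := LinearMap.det_toMatrix b _
  rw [hG, Matrix.det_mul, Matrix.det_mul, Matrix.det_transpose, hdet,
    show D.det * (metricMatrix n c' (transition n c c' y)).det * D.det =
      D.det ^ 2 * (metricMatrix n c' (transition n c c' y)).det by ring,
    Real.sqrt_mul (sq_nonneg _), Real.sqrt_sq_eq_abs]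

variable [MeasurableSpace M] [BorelSpace M]

omit [IsManifold (𝓡∂ n) ∞ M] [RiemannianBundle (fun x : M => TangentSpace (𝓡∂ n) x)] in
theorem measurableSet_extChartAt_target_inter_preimage (c : M) {s : Set M}
    (hs : MeasurableSet s) :
    MeasurableSet ((extChartAt (𝓡∂ n) c).target ∩ (extChartAt (𝓡∂ n) c).symm ⁻¹' s) := by
  have ht : MeasurableSet (extChartAt (𝓡∂ n) c).target := by
    rw [extChartAt_target]
    exact (((chartAt _ c).open_target.preimage (𝓡∂ n).continuous_symm).measurableSet).inter
      (𝓡∂ n).isClosed_range.measurableSet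
  have := (continuousOn_iff_continuous_domRestrict.1
    (continuousOn_extChartAt_symm (I := 𝓡∂ n) c)).measurable hs
  have h2 := ht.subtype_image this
  convert h2 using 1
  ext y
  simp [and_comm]

/-- The Jacobian factor in the change of variables formula is exactly the ratio of the two
densities. -/
theorem chartVolume_eq_of_subset {c c' : M} {s : Set M} (hs : MeasurableSet s)
    (hc : s ⊆ (extChartAt (𝓡∂ n) c).source) (hc' : s ⊆ (extChartAt (𝓡∂ n) c').source) :
    chartVolume n c s = chartVolume n c' s := by
  set A := (extChartAt (𝓡∂ n) c).target ∩ (extChartAt (𝓡∂ n) c).symm ⁻¹' s with hA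
  have hAm : MeasurableSet A := measurableSet_extChartAt_target_inter_preimage n c hs
  have hleft : ∀ y ∈ A, (extChartAt (𝓡∂ n) c').symm (transition n c c' y) =
      (extChartAt (𝓡∂ n) c).symm y := fun y hy => (extChartAt (𝓡∂ n) c').left_inv (hc' hy.2)
  have himage : (extChartAt (𝓡∂ n) c').target ∩ (extChartAt (𝓡∂ n) c').symm ⁻¹' s =
      transition n c c' '' A := by
    ext z
    constructor
    · rintro ⟨hz, hzs⟩
      refine ⟨extChartAt (𝓡∂ n) c ((extChartAt (𝓡∂ n) c').symm z),
        ⟨(extChartAt (𝓡∂ n) c).map_source (hc hzs), ?_⟩, ?_⟩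
      · rw [Set.mem_preimage, (extChartAt (𝓡∂ n) c).left_inv (hc hzs)]
        exact hzs
      · rw [transition, Function.comp_apply, (extChartAt (𝓡∂ n) c).left_inv (hc hzs),
          (extChartAt (𝓡∂ n) c').right_inv hz]
    · rintro ⟨y, hy, rfl⟩
      refine ⟨(extChartAt (𝓡∂ n) c').map_source (hc' hy.2), ?_⟩
      rw [Set.mem_preimage, hleft y hy]
      exact hy.2
  have hinj : Set.InjOn (transition n c c') A := by
    intro y hy z hz hyz
    apply (extChartAt (𝓡∂ n) c).symm.injOn hy.1 hz.1
    rw [← hleft y hy, ← hleft z hz, hyz]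
  rw [chartVolume_apply n c hs, chartVolume_apply n c' hs, himage,
    lintegral_image_eq_lintegral_abs_det_fderiv_mul volume hAm (f' := fun y =>
      fderivWithin ℝ (transition n c c') (Set.range (𝓡∂ n)) y) _ hinj]
  · refine setLIntegral_congr_fun hAm fun y hy => ?_
    rw [← ENNReal.ofReal_mul (abs_nonneg _),
      ← sqrt_det_metricMatrix_transition n hy.1 (hc' hy.2)]
  · exact fun y hy => (differentiableWithinAt_transition n hy.1
      (hc' hy.2)).hasFDerivWithinAt.mono fun z hz => extChartAt_target_subset_range c hz.1

omit [IsManifold (𝓡∂ n) ∞ M] in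
theorem chartVolume_inter_source (c : M) {s : Set M} (hs : MeasurableSet s) :
    chartVolume n c (s ∩ (extChartAt (𝓡∂ n) c).source) = chartVolume n c s := by
  rw [chartVolume_apply n c hs,
    chartVolume_apply n c (hs.inter (isOpen_extChartAt_source c).measurableSet)]
  congr 2
  ext y
  simp only [Set.mem_inter_iff, Set.mem_preimage, and_congr_right_iff, and_iff_left_iff_imp]
  exact fun hy _ => (extChartAt (𝓡∂ n) c).map_target hy

variable [IsContMDiffRiemannianBundle (𝓡∂ n) ∞ (EuclideanSpace ℝ (Fin n))
      (fun x : M => TangentSpace (𝓡∂ n) x)]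

theorem exists_isOpen_chartVolume_lt_top (c : M) :
    ∃ U : Set M, IsOpen U ∧ c ∈ U ∧ U ⊆ (extChartAt (𝓡∂ n) c).source ∧
      chartVolume n c U < ⊤ := by
  set y₀ := extChartAt (𝓡∂ n) c c with hy₀
  have hy₀t : y₀ ∈ (extChartAt (𝓡∂ n) c).target := mem_extChartAt_target c
  set K := Real.sqrt (metricMatrix n c y₀).det + 1 with hK
  have hev : ∀ᶠ y in 𝓝[(extChartAt (𝓡∂ n) c).target] y₀,
      Real.sqrt (metricMatrix n c y).det < K :=
    (continuousOn_sqrt_det_metricMatrix n c y₀ hy₀t).eventually_lt_const (lt_add_one _)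
  obtain ⟨r, hr, hball⟩ := Metric.mem_nhdsWithin_iff.1 hev
  refine ⟨(extChartAt (𝓡∂ n) c).source ∩ extChartAt (𝓡∂ n) c ⁻¹' Metric.ball y₀ r,
    isOpen_extChartAt_preimage' c Metric.isOpen_ball,
    ⟨mem_extChartAt_source c, Metric.mem_ball_self hr⟩, Set.inter_subset_left, ?_⟩
  have hm := (isOpen_extChartAt_preimage' (I := 𝓡∂ n) c
    (Metric.isOpen_ball (x := y₀) (ε := r))).measurableSet
  rw [chartVolume_apply n c hm]
  have hsub : (extChartAt (𝓡∂ n) c).target ∩ (extChartAt (𝓡∂ n) c).symm ⁻¹'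
      ((extChartAt (𝓡∂ n) c).source ∩ extChartAt (𝓡∂ n) c ⁻¹' Metric.ball y₀ r) ⊆
      Metric.ball y₀ r ∩ (extChartAt (𝓡∂ n) c).target := by
    rintro y ⟨hy, -, hyr⟩
    rw [Set.mem_preimage, (extChartAt (𝓡∂ n) c).right_inv hy] at hyr
    exact ⟨hyr, hy⟩
  calc _ ≤ ∫⁻ _ in (extChartAt (𝓡∂ n) c).target ∩ (extChartAt (𝓡∂ n) c).symm ⁻¹'
      ((extChartAt (𝓡∂ n) c).source ∩ extChartAt (𝓡∂ n) c ⁻¹' Metric.ball y₀ r),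
        ENNReal.ofReal K :=
        setLIntegral_mono' (measurableSet_extChartAt_target_inter_preimage n c hm)
          fun y hy => ENNReal.ofReal_le_ofReal (hball (hsub hy)).le
    _ < ⊤ := by
      rw [setLIntegral_const]
      exact ENNReal.mul_lt_top ENNReal.ofReal_lt_top
        ((measure_mono (hsub.trans Set.inter_subset_left)).trans_lt measure_ball_lt_top)

/-- A supremum of measures is bounded as soon as one measure dominates them all. Here it is a finite
sum of chart volumes over a cover by small sets: inside each small set, any chart volume agrees with
that of the covering chart on the common domain. -/
theorem isFiniteMeasure_riemannianVolume [CompactSpace M] :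
    IsFiniteMeasure (riemannianVolume n : Measure M) := by
  choose U hUo hUm hUs hUf using exists_isOpen_chartVolume_lt_top n (M := M)
  obtain ⟨t, ht⟩ := isCompact_univ.elim_nhds_subcover U fun x _ => (hUo x).mem_nhds (hUm x)
  have hle : (riemannianVolume n : Measure M) ≤
      ∑ c ∈ t, (chartVolume n c).restrict (U c) := by
    refine iSup_le fun c => Measure.le_iff.2 fun s hs => ?_
    have hsrc := (isOpen_extChartAt_source (I := 𝓡∂ n) c).measurableSet
    rw [← chartVolume_inter_source n c hs, Measure.finsetSum_apply]
    calc chartVolume n c (s ∩ (extChartAt (𝓡∂ n) c).source)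
        ≤ chartVolume n c (⋃ i ∈ t, s ∩ (extChartAt (𝓡∂ n) c).source ∩ U i) := by
          refine measure_mono fun x hx => ?_
          obtain ⟨i, hi, hxi⟩ := Set.mem_iUnion₂.1 (ht.2 (Set.mem_univ x))
          exact Set.mem_iUnion₂.2 ⟨i, hi, hx, hxi⟩
      _ ≤ ∑ i ∈ t, chartVolume n c (s ∩ (extChartAt (𝓡∂ n) c).source ∩ U i) :=
          measure_biUnion_finset_le _ _
      _ ≤ ∑ i ∈ t, (chartVolume n i).restrict (U i) s := by
          refine Finset.sum_le_sum fun i _ => ?_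
          rw [chartVolume_eq_of_subset n ((hs.inter hsrc).inter (hUo i).measurableSet)
            (fun x hx => hx.1.2) (fun x hx => hUs i hx.2), Measure.restrict_apply hs]
          exact measure_mono fun x hx => ⟨hx.1.1, hx.2⟩
  refine ⟨(hle Set.univ).trans_lt ?_⟩
  rw [Measure.finsetSum_apply]
  refine ENNReal.sum_lt_top.2 fun c _ => ?_
  rw [Measure.restrict_apply_univ]
  exact hUf c

/-- A single chart volume is a lower bound for the supremum. In that chart the set contains a
nonempty open `W`, on which the density is positive. -/
theorem riemannianVolume_inter_interior_pos {U : Set M} (hU : IsOpen U) (hne : U.Nonempty) :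
    0 < riemannianVolume n (U ∩ (𝓡∂ n).interior M) := by
  obtain ⟨x, hx⟩ := hne
  have hopen : IsOpen (U ∩ (𝓡∂ n).interior M) :=
    hU.inter ((𝓡∂ n).isOpen_interior (n := ∞) (by simp))
  refine lt_of_lt_of_le ?_ ((le_iSup (chartVolume n) x : chartVolume n x ≤ _) _)
  rw [chartVolume_apply n x hopen.measurableSet]
  have hpre : (extChartAt (𝓡∂ n) x).symm ⁻¹' U ∩ (extChartAt (𝓡∂ n) x).target ∈
      𝓝[Set.range (𝓡∂ n)] (extChartAt (𝓡∂ n) x x) := by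
    refine Filter.inter_mem ?_ (extChartAt_target_mem_nhdsWithin x)
    refine (mdifferentiableWithinAt_extChartAt_symm
      (mem_extChartAt_target x)).continuousWithinAt.preimage_mem_nhdsWithin ?_
    rw [extChartAt_to_inv]
    exact hU.mem_nhds hx
  obtain ⟨V, hVo, hVx, hV⟩ := mem_nhdsWithin.1 hpre
  set W := V ∩ interior (Set.range (𝓡∂ n)) with hW
  have hWo : IsOpen W := hVo.inter isOpen_interior
  -- The centre `x` may be a boundary point; the half-space lies in the closure of its interior, so
  -- interior points are still available nearby.
  have hWne : W.Nonempty := by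
    have : extChartAt (𝓡∂ n) x x ∈ closure (interior (Set.range (𝓡∂ n))) :=
      (𝓡∂ n).range_subset_closure_interior (extChartAt_target_subset_range x
        (mem_extChartAt_target x))
    exact mem_closure_iff.1 this V hVo hVx
  have hWt : W ⊆ (extChartAt (𝓡∂ n) x).target := fun y hy => (hV ⟨hy.1, interior_subset hy.2⟩).2
  have hWsub : W ⊆ (extChartAt (𝓡∂ n) x).target ∩ (extChartAt (𝓡∂ n) x).symm ⁻¹'
      (U ∩ (𝓡∂ n).interior M) := by
    intro y hy
    refine ⟨hWt hy, (hV ⟨hy.1, interior_subset hy.2⟩).1, ?_⟩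
    have hys : (extChartAt (𝓡∂ n) x).symm y ∈ (chartAt (EuclideanHalfSpace n) x).source := by
      rw [← extChartAt_source (𝓡∂ n)]
      exact (extChartAt (𝓡∂ n) x).map_target (hWt hy)
    refine ((𝓡∂ n).isInteriorPoint_iff_of_mem_atlas (n := ∞) (by simp)
      (chart_mem_atlas _ x) hys).2 ?_
    change extChartAt (𝓡∂ n) x ((extChartAt (𝓡∂ n) x).symm y) ∈ _
    rw [(extChartAt (𝓡∂ n) x).right_inv (hWt hy)]
    exact mem_interior.2 ⟨W, hWt, hWo, hy⟩
  refine lt_of_lt_of_le ?_ (lintegral_mono_set hWsub)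
  have hm : AEMeasurable (fun y => ENNReal.ofReal (Real.sqrt (metricMatrix n x y).det))
      (volume.restrict W) :=
    (((continuousOn_sqrt_det_metricMatrix n x).mono hWt).aemeasurable
      hWo.measurableSet).ennreal_ofReal
  rw [pos_iff_ne_zero, Ne, lintegral_eq_zero_iff' hm]
  intro h0
  rw [Filter.EventuallyEq, ae_restrict_iff' hWo.measurableSet] at h0
  have : ∀ᵐ y, y ∉ W := by
    filter_upwards [h0] with y hy hyW
    have := hy hyW
    simp only [Pi.zero_apply, ENNReal.ofReal_eq_zero] at this
    exact absurd (Real.sqrt_pos.2 (metricMatrix_posDef n (hWt hyW)).det_pos) this.not_gt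
  exact (hWo.measure_pos volume hWne).ne' (by simpa [ae_iff] using this)

end Volume

/-! ### Calculus of the gradient and the Lipschitz bound -/

section Gradient

variable (n : ℕ) [NeZero n] {M : Type*} [TopologicalSpace M] [ChartedSpace (EuclideanHalfSpace n) M]
  [RiemannianBundle (fun x : M => TangentSpace (𝓡∂ n) x)]

theorem grad_mul {f h : M → ℝ} {x : M} (hf : MDifferentiableAt (𝓡∂ n) 𝓘(ℝ, ℝ) f x)
    (hh : MDifferentiableAt (𝓡∂ n) 𝓘(ℝ, ℝ) h x) :
    grad n (fun z => f z * h z) x = f x • grad n h x + h x • grad n f x := by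
  refine ext_inner_right ℝ fun v => ?_
  rw [inner_add_left, inner_smul_left, inner_smul_left, inner_grad, inner_grad, inner_grad]
  exact DFunLike.congr_fun (hf.hasMFDerivAt.mul hh.hasMFDerivAt).mfderiv v

theorem grad_sub {f h : M → ℝ} {x : M} (hf : MDifferentiableAt (𝓡∂ n) 𝓘(ℝ, ℝ) f x)
    (hh : MDifferentiableAt (𝓡∂ n) 𝓘(ℝ, ℝ) h x) :
    grad n (fun z => f z - h z) x = grad n f x - grad n h x := by
  refine ext_inner_right ℝ fun v => ?_
  rw [inner_sub_left, inner_grad, inner_grad, inner_grad]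
  exact DFunLike.congr_fun (hf.hasMFDerivAt.sub hh.hasMFDerivAt).mfderiv v

theorem grad_comp {g : ℝ → ℝ} {g' : ℝ} {f : M → ℝ} {x : M} (hg : HasDerivAt g g' (f x))
    (hf : MDifferentiableAt (𝓡∂ n) 𝓘(ℝ, ℝ) f x) :
    grad n (fun z => g (f z)) x = g' • grad n f x := by
  refine ext_inner_right ℝ fun v => ?_
  rw [inner_smul_left, inner_grad, inner_grad]
  refine (DFunLike.congr_fun ((hg.hasFDerivAt.hasMFDerivAt).comp x hf.hasMFDerivAt).mfderiv v).trans
    ?_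
  exact mul_comm (G := ℝ) _ _

theorem enorm_mfderiv_apply_le (f : M → ℝ) (x : M) (v : TangentSpace (𝓡∂ n) x) :
    ‖(show ℝ from mfderiv (𝓡∂ n) 𝓘(ℝ, ℝ) f x v)‖ₑ ≤ ENNReal.ofReal ‖grad n f x‖ * ‖v‖ₑ := by
  have h : |(inner ℝ (grad n f x) v : ℝ)| ≤ ‖grad n f x‖ * ‖v‖ := abs_real_inner_le_norm _ _
  rw [inner_grad] at h
  rw [← ofReal_norm v, ← ENNReal.ofReal_mul (norm_nonneg _), ← ofReal_norm]
  exact ENNReal.ofReal_le_ofReal h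

/-- Along a `C^1` curve `γ` the derivative of `f ∘ γ` is at most `K |γ'|`, so `f` varies by at most
`K` times the length. Curves of length arbitrarily close to the distance finish the proof. -/
theorem enorm_sub_le_mul_riemannianEDist {f : M → ℝ} (hf : ContMDiff (𝓡∂ n) 𝓘(ℝ, ℝ) 1 f)
    {K : ℝ} (hK : ∀ x, ‖grad n f x‖ ≤ K) (hK0 : 0 < K) (x y : M) :
    ‖f x - f y‖ₑ ≤ ENNReal.ofReal K * Manifold.riemannianEDist (𝓡∂ n) x y := by
  have hK' : ENNReal.ofReal K ≠ 0 := by simpa using hK0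
  rw [mul_comm, ← ENNReal.div_le_iff hK' ENNReal.ofReal_ne_top]
  refine le_of_forall_gt fun r hr => ?_
  rw [Manifold.riemannianEDist_comm] at hr
  obtain ⟨γ, h0, h1, hγ, hlen⟩ := Manifold.exists_lt_of_riemannianEDist_lt hr
  refine lt_of_le_of_lt ?_ hlen
  rw [ENNReal.div_le_iff hK' ENNReal.ofReal_ne_top, mul_comm]
  have hD : ContDiffOn ℝ 1 (f ∘ γ) (Set.Icc 0 1) :=
    contMDiffOn_iff_contDiffOn.1 (hf.comp_contMDiffOn hγ)
  have h2 := enorm_sub_le_lintegral_derivWithin_Icc_of_contDiffOn_Icc hD zero_le_one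
  simp only [Function.comp_apply, h0, h1] at h2
  refine h2.trans ?_
  rw [Manifold.pathELength_eq_lintegral_mfderivWithin_Icc,
    ← lintegral_const_mul' _ _ ENNReal.ofReal_ne_top]
  refine setLIntegral_mono' measurableSet_Icc fun t ht => ?_
  have hcomp := mfderiv_comp_mfderivWithin t (hf.mdifferentiableAt (by simp) (x := γ t))
    (hγ.mdifferentiableOn (by simp) t ht) (uniqueDiffOn_Icc_zero_one t ht).uniqueMDiffWithinAt
  have h3 : derivWithin (f ∘ γ) (Set.Icc 0 1) t = mfderiv (𝓡∂ n) 𝓘(ℝ, ℝ) f (γ t)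
      (mfderivWithin 𝓘(ℝ, ℝ) (𝓡∂ n) γ (Set.Icc 0 1) t 1) := by
    rw [← fderivWithin_derivWithin, ← mfderivWithin_eq_fderivWithin]
    exact DFunLike.congr_fun hcomp (1 : ℝ)
  rw [h3]
  refine (enorm_mfderiv_apply_le n f (γ t) _).trans ?_
  gcongr
  exact hK _

end Gradient

/-! ### Inequalities for real powers -/

section Elementary

theorem rpow_sub_two_mul_self {p : ℝ} (hp : 1 < p) {x : ℝ} (hx : 0 ≤ x) :
    x ^ (p - 2) * x = x ^ (p - 1) := by
  rw [← Real.rpow_add_one' hx (by linarith)]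
  ring_nf

theorem rpow_sub_one_mul_self {p : ℝ} (hp : 1 < p) {x : ℝ} (hx : 0 ≤ x) :
    x ^ (p - 1) * x = x ^ p := by
  rw [← Real.rpow_add_one' hx (by linarith)]
  ring_nf

theorem rpow_sub_two_mul_sq {p : ℝ} (hp : 1 < p) {x : ℝ} (hx : 0 ≤ x) :
    x ^ (p - 2) * x ^ 2 = x ^ p := by
  rw [sq, ← mul_assoc, rpow_sub_two_mul_self hp hx, rpow_sub_one_mul_self hp hx]

/-- Young's inequality with a crude constant: according to whether `b ≤ δ s` or not, one of the two
terms alone is large enough. -/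
theorem mul_rpow_sub_one_mul_le {p δ s b : ℝ} (hp : 1 < p) (hδ : 0 < δ) (hs : 0 ≤ s)
    (hb : 0 ≤ b) : s ^ (p - 1) * b ≤ δ * s ^ p + δ ^ (1 - p) * b ^ p := by
  rcases le_total b (δ * s) with h | h
  · calc s ^ (p - 1) * b ≤ s ^ (p - 1) * (δ * s) := by gcongr
      _ = δ * s ^ p := by rw [← rpow_sub_one_mul_self hp hs]; ring
      _ ≤ _ := le_add_of_nonneg_right (by positivity)
  · have h1 : s ≤ δ⁻¹ * b := by rwa [inv_mul_eq_div, le_div_iff₀' hδ]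
    calc s ^ (p - 1) * b ≤ (δ⁻¹ * b) ^ (p - 1) * b := by
          gcongr
      _ = δ ^ (1 - p) * b ^ p := by
          rw [Real.mul_rpow (by positivity) hb, mul_assoc, rpow_sub_one_mul_self hp hb,
            Real.inv_rpow hδ.le, ← Real.rpow_neg hδ.le, neg_sub]
      _ ≤ _ := le_add_of_nonneg_left (by positivity)

theorem le_add_rpow {p ε s : ℝ} (hp : 1 < p) (hε : 0 < ε) (hs : 0 ≤ s) :
    s ≤ ε + ε ^ (1 - p) * s ^ p := by
  simpa using mul_rpow_sub_one_mul_le (s := 1) hp hε zero_le_one hs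

/-- The pointwise form of Picone's inequality that yields the Hardy inequality. -/
theorem picone_le {p a b h s : ℝ} (hp : 1 < p) (ha : 0 ≤ a) (hb : 0 ≤ b) (hs : |s| ≤ a * b) :
    a ^ (p - 2) * (p * |h| ^ (p - 2) * h * s - (p - 1) * |h| ^ p * a ^ 2) ≤
      p * ((p - 1) / (2 * p)) ^ (1 - p) * b ^ p - (p - 1) / 2 * (|h| ^ p * a ^ p) := by
  -- With this `δ` in Young's inequality, `p δ = (p - 1) / 2`, so exactly half of the negative term
  -- is used up.
  have hδ : 0 < (p - 1) / (2 * p) := div_pos (by linarith) (by linarith)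
  have h1 : a ^ (p - 2) * (|h| ^ (p - 2) * h * s) ≤ (|h| * a) ^ (p - 1) * b := by
    calc a ^ (p - 2) * (|h| ^ (p - 2) * h * s)
        ≤ a ^ (p - 2) * (|h| ^ (p - 2) * (|h| * (a * b))) := by
          rw [mul_assoc (|h| ^ (p - 2))]
          have h0 : h * s ≤ |h| * (a * b) := (le_abs_self _).trans ((abs_mul h s).le.trans
            (mul_le_mul_of_nonneg_left hs (abs_nonneg h)))
          exact mul_le_mul_of_nonneg_left (mul_le_mul_of_nonneg_left h0 (by positivity))
            (by positivity)
      _ = (a ^ (p - 2) * a) * (|h| ^ (p - 2) * |h|) * b := by ring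
      _ = (|h| * a) ^ (p - 1) * b := by
          rw [rpow_sub_two_mul_self hp ha, rpow_sub_two_mul_self hp (abs_nonneg h),
            Real.mul_rpow (abs_nonneg h) ha]
          ring
  have h2 := mul_rpow_sub_one_mul_le hp hδ (mul_nonneg (abs_nonneg h) ha) hb
  rw [Real.mul_rpow (abs_nonneg h) ha (z := p)] at h2
  have h3 : a ^ (p - 2) * (p * |h| ^ (p - 2) * h * s - (p - 1) * |h| ^ p * a ^ 2) =
      p * (a ^ (p - 2) * (|h| ^ (p - 2) * h * s)) - (p - 1) * (|h| ^ p * a ^ p) := by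
    rw [← rpow_sub_two_mul_sq hp ha]
    ring
  rw [h3]
  have h4 := mul_le_mul_of_nonneg_left (h1.trans h2) (by linarith : 0 ≤ p)
  have h5 : p * ((p - 1) / (2 * p)) = (p - 1) / 2 := by
    have : p ≠ 0 := by linarith
    field_simp
  have h6 : p * ((p - 1) / (2 * p) * (|h| ^ p * a ^ p) +
      ((p - 1) / (2 * p)) ^ (1 - p) * b ^ p) =
      (p - 1) / 2 * (|h| ^ p * a ^ p) + p * ((p - 1) / (2 * p)) ^ (1 - p) * b ^ p := by
    rw [← h5]; ring
  rw [h6] at h4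
  linarith

/-- On a finite measure space `L^p` convergence gives `L^1` convergence. Instead of Hölder, `s ≤ ε +
ε^{1-p} s^p` is integrated; `k → ∞` for fixed `ε` leaves a multiple of `ε`, and `ε → 0` concludes.
-/
theorem nonpos_of_le_integral_of_tendsto_lintegral_rpow {X : Type*} [MeasurableSpace X]
    {μ : Measure X} [IsFiniteMeasure μ] {p A C : ℝ} (hp : 1 < p) (hC : 0 ≤ C)
    {d e : ℕ → X → ℝ} (hd0 : ∀ k x, 0 ≤ d k x) (he0 : ∀ k x, 0 ≤ e k x)
    (hd : ∀ k, Integrable (d k) μ) (he : ∀ k, Integrable (e k) μ)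
    (hde : ∀ k, Integrable (fun x => d k x ^ p + e k x ^ p) μ)
    (hA : ∀ k, A ≤ C * ∫ x, d k x + e k x ∂μ)
    (hlim : Filter.Tendsto (fun k => ∫⁻ x, ENNReal.ofReal (d k x ^ p + e k x ^ p) ∂μ)
      Filter.atTop (𝓝 0)) : A ≤ 0 := by
  have hlim' : Filter.Tendsto (fun k => ∫ x, d k x ^ p + e k x ^ p ∂μ) Filter.atTop (𝓝 0) := by
    have h := (ENNReal.tendsto_toReal ENNReal.zero_ne_top).comp hlim
    refine h.congr fun k => ?_
    rw [Function.comp_apply, integral_eq_lintegral_of_nonneg_ae _ (hde k).aestronglyMeasurable]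
    exact ae_of_all _ fun x => add_nonneg (Real.rpow_nonneg (hd0 k x) _)
      (Real.rpow_nonneg (he0 k x) _)
  have key : ∀ ε : ℝ, 0 < ε → A ≤ C * (2 * ε * μ.real Set.univ) := by
    intro ε hε
    have hk : ∀ k, A ≤ C * (2 * ε * μ.real Set.univ +
        ε ^ (1 - p) * ∫ x, d k x ^ p + e k x ^ p ∂μ) := by
      intro k
      refine (hA k).trans (mul_le_mul_of_nonneg_left ?_ hC)
      calc ∫ x, d k x + e k x ∂μ
          ≤ ∫ x, (2 * ε + ε ^ (1 - p) * (d k x ^ p + e k x ^ p)) ∂μ := by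
            refine integral_mono ((hd k).add (he k))
              ((integrable_const _).add ((hde k).const_mul _)) fun x => ?_
            have h1 := le_add_rpow hp hε (hd0 k x)
            have h2 := le_add_rpow hp hε (he0 k x)
            simp only
            linarith
        _ = _ := by
            rw [integral_add (integrable_const _) ((hde k).const_mul _), integral_const, smul_eq_mul,
              mul_comm (μ.real _), integral_const_mul (ε ^ (1 - p))]
    have ht := ((hlim'.const_mul (ε ^ (1 - p))).const_add (2 * ε * μ.real Set.univ)).const_mul C
    rw [mul_zero, add_zero] at ht
    exact ge_of_tendsto' ht hk
  have ht : Filter.Tendsto (fun ε : ℝ => C * (2 * ε * μ.real Set.univ)) (𝓝[>] 0) (𝓝 0) := by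
    have : Continuous fun ε : ℝ => C * (2 * ε * μ.real Set.univ) := by fun_prop
    simpa using (this.tendsto 0).mono_left nhdsWithin_le_nhds
  exact ge_of_tendsto ht (eventually_mem_nhdsWithin.mono fun ε hε => key ε hε)

end Elementary

/-! ### Test functions -/

section TestFunctions

variable (n : ℕ) [NeZero n] {M : Type*} [TopologicalSpace M] [ChartedSpace (EuclideanHalfSpace n) M]

theorem IsTest.one {u : M → ℝ} (hu : IsTest n ⊤ u) : IsTest n 1 u :=
  ⟨hu.1.of_le (by exact_mod_cast le_top), hu.2⟩

/-- On the support of `u` the denominator is positive; off it the quotient is locally `0`, whatever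
the value of `φ`. -/
theorem IsTest.div {u φ : M → ℝ} (hu : IsTest n 1 u) (hφ : ContMDiff (𝓡∂ n) 𝓘(ℝ, ℝ) 1 φ)
    (hpos : ∀ x ∈ (𝓡∂ n).interior M, 0 < φ x) : IsTest n 1 fun x => u x / φ x := by
  have hsub : Function.support (fun x => u x / φ x) ⊆ Function.support u := fun x hx hux =>
    hx (by simp only [hux, zero_div])
  refine ⟨fun x => ?_, hu.2.1.mono hsub, (closure_mono hsub).trans hu.2.2⟩
  by_cases hx : x ∈ tsupport u
  · exact (hu.1 x).div₀ (hφ x) (hpos x (hu.2.2 hx)).ne'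
  · have hev : (fun x => u x / φ x) =ᶠ[𝓝 x] fun _ => 0 := by
      filter_upwards [(isClosed_tsupport u).isOpen_compl.mem_nhds hx] with z hz
      rw [image_eq_zero_of_notMem_tsupport hz, zero_div]
    exact contMDiffAt_const.congr_of_eventuallyEq hev

end TestFunctions

/-! ### Positivity of the eigenvalue and Picone's estimate -/

section Hardy

variable (n : ℕ) [NeZero n] {M : Type*} [TopologicalSpace M] [CompactSpace M]
  [ChartedSpace (EuclideanHalfSpace n) M] [IsManifold (𝓡∂ n) ∞ M]
  [RiemannianBundle (fun x : M => TangentSpace (𝓡∂ n) x)]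
  [IsContMDiffRiemannianBundle (𝓡∂ n) ∞ (EuclideanSpace ℝ (Fin n))
    (fun x : M => TangentSpace (𝓡∂ n) x)]
  [MeasurableSpace M] [BorelSpace M]

theorem integrable_interior_of_continuous {f : M → ℝ} (hf : Continuous f) :
    Integrable f ((riemannianVolume n).restrict ((𝓡∂ n).interior M)) := by
  have := isFiniteMeasure_riemannianVolume n (M := M)
  obtain ⟨C, hC⟩ := (isCompact_univ.image hf).isBounded.exists_norm_le
  exact Integrable.of_bound hf.measurable.aestronglyMeasurable C
    (ae_of_all _ fun x => hC _ ⟨x, Set.mem_univ x, rfl⟩)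

/-- For `p < 2` the factor `|∇f|^{p-2}` is unbounded near zeros of the gradient, so the product is
dominated by the continuous function `|∇f|^{p-1} |∇h|`. -/
theorem integrable_norm_grad_rpow_mul_inner {p : ℝ} (hp : 1 < p) {f h : M → ℝ}
    (hf : ContMDiff (𝓡∂ n) 𝓘(ℝ, ℝ) 1 f) (hh : ContMDiff (𝓡∂ n) 𝓘(ℝ, ℝ) 1 h) :
    Integrable (fun x => ‖grad n f x‖ ^ (p - 2) * (inner ℝ (grad n f x) (grad n h x) : ℝ))
      ((riemannianVolume n).restrict ((𝓡∂ n).interior M)) := by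
  have hb : Continuous fun x => ‖grad n f x‖ ^ (p - 1) * ‖grad n h x‖ :=
    ((continuous_norm_grad n hf).rpow_const fun _ => Or.inr (by linarith)).mul
      (continuous_norm_grad n hh)
  refine (integrable_interior_of_continuous n hb).mono'
    ((((continuous_norm_grad n hf).measurable.pow_const _).mul
      (continuous_inner_grad n hf hh).measurable).aestronglyMeasurable) (ae_of_all _ fun x => ?_)
  rw [norm_mul, Real.norm_of_nonneg (Real.rpow_nonneg (norm_nonneg _) _)]
  calc _ ≤ ‖grad n f x‖ ^ (p - 2) * (‖grad n f x‖ * ‖grad n h x‖) := by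
        gcongr
        exact abs_real_inner_le_norm _ _
    _ = _ := by rw [← mul_assoc, rpow_sub_two_mul_self hp (norm_nonneg _)]

theorem integrable_abs_rpow_mul {p : ℝ} (hp : 1 < p) {f h : M → ℝ} (hf : Continuous f)
    (hh : Continuous h) : Integrable (fun x => |f x| ^ (p - 2) * f x * h x)
      ((riemannianVolume n).restrict ((𝓡∂ n).interior M)) := by
  have hb : Continuous fun x => |f x| ^ (p - 1) * |h x| :=
    (hf.abs.rpow_const fun _ => Or.inr (by linarith)).mul hh.abs
  refine (integrable_interior_of_continuous n hb).mono'
    (((hf.abs.measurable.pow_const _).mul hf.measurable).mul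
      hh.measurable).aestronglyMeasurable (ae_of_all _ fun x => ?_)
  rw [norm_mul, norm_mul, Real.norm_of_nonneg (Real.rpow_nonneg (abs_nonneg _) _),
    Real.norm_eq_abs, Real.norm_eq_abs, rpow_sub_two_mul_self hp (abs_nonneg _)]

/-- Testing the equation with a sequence that approximates the eigenfunction shows that
nonpositive eigenvalues force the gradient to vanish. -/
theorem IsDirichletEigenpair.integral_norm_grad_rpow_nonpos {p lam : ℝ} (hp : 1 < p) {φ : M → ℝ}
    (hφ : ContMDiff (𝓡∂ n) 𝓘(ℝ, ℝ) 1 φ) (h : IsDirichletEigenpair n p lam φ (grad n φ))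
    (hlam : lam ≤ 0) :
    ∫ x in (𝓡∂ n).interior M, ‖grad n φ x‖ ^ p ∂riemannianVolume n ≤ 0 := by
  have hfin := isFiniteMeasure_riemannianVolume n (M := M)
  obtain ⟨⟨-, -, u, hu, hlim⟩, -, heq⟩ := h
  have hu1 : ∀ k, ContMDiff (𝓡∂ n) 𝓘(ℝ, ℝ) 1 (u k) := fun k => ((hu k).one n).1
  have hφd := fun x => hφ.mdifferentiableAt (by simp) (x := x)
  have hg : ∀ k x, grad n (fun z => u k z - φ z) x = grad n (u k) x - grad n φ x := fun k x =>
    grad_sub n ((hu1 k).mdifferentiableAt (by simp)) (hφd x)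
  have hdc : ∀ k, Continuous fun x => |u k x - φ x| := fun k =>
    ((hu1 k).continuous.sub hφ.continuous).abs
  have hec : ∀ k, Continuous fun x => ‖grad n (u k) x - grad n φ x‖ := fun k => by
    simpa only [hg] using continuous_norm_grad n ((hu1 k).sub hφ)
  have hac : Continuous fun x => ‖grad n φ x‖ := continuous_norm_grad n hφ
  obtain ⟨K₁, hK₁⟩ := (isCompact_univ.image
    (hac.rpow_const (p := p - 1) fun _ => Or.inr (by linarith))).isBounded.exists_norm_le
  obtain ⟨K₂, hK₂⟩ := (isCompact_univ.image
    (hφ.continuous.abs.rpow_const (p := p - 1) fun _ =>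
      Or.inr (by linarith))).isBounded.exists_norm_le
  have hK₁' : ∀ x, ‖grad n φ x‖ ^ (p - 1) ≤ K₁ := fun x =>
    (le_abs_self _).trans (hK₁ _ ⟨x, Set.mem_univ x, rfl⟩)
  have hK₂' : ∀ x, |φ x| ^ (p - 1) ≤ K₂ := fun x =>
    (le_abs_self _).trans (hK₂ _ ⟨x, Set.mem_univ x, rfl⟩)
  refine nonpos_of_le_integral_of_tendsto_lintegral_rpow (C := |K₁| + -lam * |K₂|) hp
    (add_nonneg (abs_nonneg _) (mul_nonneg (by linarith) (abs_nonneg _)))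
    (d := fun k x => |u k x - φ x|) (e := fun k x => ‖grad n (u k) x - grad n φ x‖)
    (fun _ _ => abs_nonneg _) (fun _ _ => norm_nonneg _)
    (fun k => integrable_interior_of_continuous n (hdc k))
    (fun k => integrable_interior_of_continuous n (hec k))
    (fun k => integrable_interior_of_continuous n
      (((hdc k).rpow_const fun _ => Or.inr (by linarith)).add
        ((hec k).rpow_const fun _ => Or.inr (by linarith)))) (fun k => ?_) hlim
  have hI := integrable_interior_of_continuous n (M := M)
    (hac.rpow_const (p := p) fun _ => Or.inr (by linarith))
  have hI₁ := integrable_norm_grad_rpow_mul_inner n hp hφ (hu1 k)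
  have hI₂ := integrable_abs_rpow_mul n hp hφ.continuous (hu1 k).continuous
  have hI₃ := (integrable_interior_of_continuous n ((hdc k).add (hec k))).const_mul
    (|K₁| + -lam * |K₂|)
  have hI₄ : Integrable (fun x => ‖grad n φ x‖ ^ (p - 2) * inner ℝ (grad n φ x) (grad n (u k) x) -
      lam * (|φ x| ^ (p - 2) * φ x * u k x))
      ((riemannianVolume n).restrict ((𝓡∂ n).interior M)) := hI₁.sub (hI₂.const_mul lam)
  -- Replacing `φ` by `u k` costs at most `K₁` times the gradient error and `K₂` times the value
  -- error. The term `-lam |φ|^p` has the good sign and is dropped; the first two terms on the right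
  -- cancel after integration by the equation.
  have hpt : ∀ x, ‖grad n φ x‖ ^ p ≤
      ‖grad n φ x‖ ^ (p - 2) * inner ℝ (grad n φ x) (grad n (u k) x) -
        lam * (|φ x| ^ (p - 2) * φ x * u k x) +
      (|K₁| + -lam * |K₂|) * (|u k x - φ x| + ‖grad n (u k) x - grad n φ x‖) := by
    intro x
    have e1 : ‖grad n φ x‖ ^ p - |K₁| * ‖grad n (u k) x - grad n φ x‖ ≤
        ‖grad n φ x‖ ^ (p - 2) * inner ℝ (grad n φ x) (grad n (u k) x) := by
      have h1 : (inner ℝ (grad n φ x) (grad n (u k) x) : ℝ) =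
          ‖grad n φ x‖ ^ 2 + inner ℝ (grad n φ x) (grad n (u k) x - grad n φ x) := by
        rw [inner_sub_right, real_inner_self_eq_norm_sq]; ring
      have h2 := neg_le_of_abs_le
        (abs_real_inner_le_norm (grad n φ x) (grad n (u k) x - grad n φ x))
      rw [h1, mul_add, rpow_sub_two_mul_sq hp (norm_nonneg _)]
      have h3 := mul_le_mul_of_nonneg_left h2
        (Real.rpow_nonneg (norm_nonneg (grad n φ x)) (p - 2))
      rw [mul_neg, ← mul_assoc, rpow_sub_two_mul_self hp (norm_nonneg _)] at h3
      have h4 := mul_le_mul_of_nonneg_right ((hK₁' x).trans (le_abs_self _))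
        (norm_nonneg (grad n (u k) x - grad n φ x))
      linarith
    have e2 : -(|K₂| * |u k x - φ x|) ≤ |φ x| ^ (p - 2) * φ x * u k x := by
      have h1 : |φ x| ^ (p - 2) * φ x * u k x =
          |φ x| ^ p + |φ x| ^ (p - 2) * φ x * (u k x - φ x) := by
        rw [← rpow_sub_two_mul_sq hp (abs_nonneg _), sq_abs]; ring
      have h2 : |(|φ x| ^ (p - 2) * φ x * (u k x - φ x))| ≤ |K₂| * |u k x - φ x| := by
        rw [abs_mul, abs_mul, abs_of_nonneg (Real.rpow_nonneg (abs_nonneg _) _),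
          rpow_sub_two_mul_self hp (abs_nonneg _)]
        gcongr
        exact (hK₂' x).trans (le_abs_self _)
      have h3 := neg_le_of_abs_le h2
      have h4 : 0 ≤ |φ x| ^ p := by positivity
      linarith
    have e3 := mul_le_mul_of_nonneg_left e2 (neg_nonneg.2 hlam)
    have e4 : 0 ≤ |K₁| * |u k x - φ x| := by positivity
    have e5 : 0 ≤ -lam * (|K₂| * ‖grad n (u k) x - grad n φ x‖) :=
      mul_nonneg (neg_nonneg.2 hlam) (by positivity)
    nlinarith
  calc _ ≤ ∫ x in (𝓡∂ n).interior M,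
        (‖grad n φ x‖ ^ (p - 2) * inner ℝ (grad n φ x) (grad n (u k) x) -
        lam * (|φ x| ^ (p - 2) * φ x * u k x) +
      (|K₁| + -lam * |K₂|) * (|u k x - φ x| + ‖grad n (u k) x - grad n φ x‖))
        ∂riemannianVolume n :=
        integral_mono hI (hI₄.add hI₃) hpt
    _ = _ := by
        rw [← integral_const_mul]
        refine (integral_add hI₄ hI₃).trans ?_
        rw [integral_sub hI₁ (hI₂.const_mul lam), integral_const_mul lam, heq _ ((hu k).one n),
          sub_self, zero_add]
        rfl

/-- If `lam ≤ 0`, the gradient vanishes almost everywhere in the interior. It is nonzero on an open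
neighbourhood of `x₀`, which has positive interior volume even if `x₀` is a boundary point. -/
theorem IsDirichletEigenpair.pos {p lam : ℝ} (hp : 1 < p) {φ : M → ℝ}
    (hφ : ContMDiff (𝓡∂ n) 𝓘(ℝ, ℝ) 1 φ) (h : IsDirichletEigenpair n p lam φ (grad n φ))
    {x₀ : M} (hx₀ : grad n φ x₀ ≠ 0) : 0 < lam := by
  by_contra hlam
  have hle := h.integral_norm_grad_rpow_nonpos n hp hφ (not_lt.1 hlam)
  have hac : Continuous fun x => ‖grad n φ x‖ := continuous_norm_grad n hφ
  have hI := integrable_interior_of_continuous n (M := M)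
    (hac.rpow_const (p := p) fun _ => Or.inr (by linarith))
  have hnn : ∀ x, 0 ≤ ‖grad n φ x‖ ^ p := fun x => Real.rpow_nonneg (norm_nonneg _) _
  have h0 := (integral_eq_zero_iff_of_nonneg hnn hI).1 (le_antisymm hle (integral_nonneg hnn))
  have hopen : IsOpen {x | 0 < ‖grad n φ x‖} := isOpen_lt continuous_const hac
  refine (riemannianVolume_inter_interior_pos n hopen ⟨x₀, norm_pos_iff.2 hx₀⟩).ne' ?_
  rw [← Measure.restrict_apply hopen.measurableSet]
  refine measure_mono_null (fun x hx => ?_) (ae_iff.1 h0)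
  exact (Real.rpow_pos_of_pos hx p).ne'

/-- The weighted estimate obtained by testing the equation with `|u|^p φ^{1-p}`. -/
theorem IsDirichletEigenpair.picone {p lam : ℝ} (hp : 1 < p) {φ : M → ℝ}
    (hφ : ContMDiff (𝓡∂ n) 𝓘(ℝ, ℝ) 1 φ) (hφ0 : ∀ x, 0 ≤ φ x)
    (hpair : IsDirichletEigenpair n p lam φ (grad n φ)) {u h : M → ℝ}
    (hu : ContMDiff (𝓡∂ n) 𝓘(ℝ, ℝ) 1 u) (hh : IsTest n 1 h) (huh : ∀ x, u x = h x * φ x) :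
    ∫ x in (𝓡∂ n).interior M,
        |h x| ^ p * ((p - 1) / 2 * ‖grad n φ x‖ ^ p + lam * φ x ^ p) ∂riemannianVolume n ≤
      p * ((p - 1) / (2 * p)) ^ (1 - p) *
        ∫ x in (𝓡∂ n).interior M, ‖grad n u x‖ ^ p ∂riemannianVolume n := by
  set v : M → ℝ := fun x => |h x| ^ p * φ x with hv
  -- For `p > 1` the function `|t|^p` is `C^1`, so `v` is an admissible `C^1` test function.
  have habs : ContMDiff (𝓡∂ n) 𝓘(ℝ, ℝ) 1 fun x => |h x| ^ p :=
    ((contDiff_norm_rpow (E := ℝ) hp).contMDiff).comp hh.1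
  have hv1 : ContMDiff (𝓡∂ n) 𝓘(ℝ, ℝ) 1 v := habs.mul hφ
  have hsub : Function.support v ⊆ Function.support h := fun x hx hhx =>
    hx (by simp only [hv, hhx, abs_zero, Real.zero_rpow (by linarith : p ≠ 0), zero_mul])
  have hvt : IsTest n 1 v := ⟨hv1, hh.2.1.mono hsub, (closure_mono hsub).trans hh.2.2⟩
  have hφd := fun x => hφ.mdifferentiableAt (by simp) (x := x)
  have hhd := fun x => hh.1.mdifferentiableAt (by simp) (x := x)
  have hgu : ∀ x, grad n u x = h x • grad n φ x + φ x • grad n h x := fun x => by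
    rw [← grad_mul n (hhd x) (hφd x), funext huh]
  have hgv : ∀ x, grad n v x = |h x| ^ p • grad n φ x +
      φ x • (p * |h x| ^ (p - 2) * h x) • grad n h x := fun x => by
    rw [grad_mul n (habs.mdifferentiableAt (by simp)) (hφd x),
      grad_comp n (hasDerivAt_abs_rpow (h x) hp) (hhd x)]
  -- Substituting `φ ∇h = ∇u - h ∇φ` eliminates `∇h`; the two `|h|^p |∇φ|²` terms combine to the
  -- coefficient `1 - p`.
  have hinner : ∀ x, (inner ℝ (grad n φ x) (grad n v x) : ℝ) =
      p * |h x| ^ (p - 2) * h x * inner ℝ (grad n φ x) (grad n u x) -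
        (p - 1) * |h x| ^ p * ‖grad n φ x‖ ^ 2 := fun x => by
    rw [hgv, hgu, inner_add_right, inner_add_right, inner_smul_right, inner_smul_right,
      inner_smul_right, inner_smul_right, inner_smul_right, real_inner_self_eq_norm_sq,
      ← rpow_sub_two_mul_sq hp (abs_nonneg (h x)), sq_abs]
    ring
  have hac := (continuous_norm_grad n hφ).rpow_const (p := p) fun _ => Or.inr (by linarith)
  have huc := (continuous_norm_grad n hu).rpow_const (p := p) fun _ => Or.inr (by linarith)
  have hI := integrable_interior_of_continuous n (M := M)
    (habs.continuous.mul ((hac.const_mul ((p - 1) / 2)).add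
      ((hφ.continuous.rpow_const (p := p) fun _ => Or.inr (by linarith)).const_mul lam)))
  have hI₁ := integrable_norm_grad_rpow_mul_inner n hp hφ hv1
  have hI₂ := integrable_abs_rpow_mul n hp hφ.continuous hv1.continuous
  have hI₃ := (integrable_interior_of_continuous n huc).const_mul
    (p * ((p - 1) / (2 * p)) ^ (1 - p))
  have hI₄ : Integrable (fun x => ‖grad n φ x‖ ^ (p - 2) * inner ℝ (grad n φ x) (grad n v x) -
      lam * (|φ x| ^ (p - 2) * φ x * v x))
      ((riemannianVolume n).restrict ((𝓡∂ n).interior M)) := hI₁.sub (hI₂.const_mul lam)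
  rw [← integral_const_mul]
  have hpt : ∀ x, |h x| ^ p * ((p - 1) / 2 * ‖grad n φ x‖ ^ p + lam * φ x ^ p) ≤
      p * ((p - 1) / (2 * p)) ^ (1 - p) * ‖grad n u x‖ ^ p -
        (‖grad n φ x‖ ^ (p - 2) * inner ℝ (grad n φ x) (grad n v x) -
          lam * (|φ x| ^ (p - 2) * φ x * v x)) := by
    intro x
    have h1 := picone_le (h := h x) hp (norm_nonneg (grad n φ x)) (norm_nonneg (grad n u x))
      (abs_real_inner_le_norm _ _)
    rw [← hinner] at h1
    have h2 : |φ x| ^ (p - 2) * φ x * v x = |h x| ^ p * φ x ^ p := by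
      rw [abs_of_nonneg (hφ0 x), ← rpow_sub_two_mul_sq hp (hφ0 x)]
      ring
    rw [h2]
    linarith
  refine (integral_mono hI (hI₃.sub hI₄) hpt).trans_eq ((integral_sub hI₃ hI₄).trans ?_)
  rw [integral_sub hI₁ (hI₂.const_mul lam),
    integral_const_mul lam, hpair.2.2 v hvt, sub_self, sub_zero]

end Hardy

end HardyManifold

end

/-! ### The Hardy inequality -/

theorem mainTheorem11 (n : ℕ) [NeZero n] (M : Type*) [EMetricSpace M] [CompactSpace M]
    [ChartedSpace (EuclideanHalfSpace n) M] [IsManifold (𝓡∂ n) ∞ M]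
    [RiemannianBundle (fun x : M => TangentSpace (𝓡∂ n) x)]
    [IsContMDiffRiemannianBundle (𝓡∂ n) ∞ (EuclideanSpace ℝ (Fin n))
      (fun x : M => TangentSpace (𝓡∂ n) x)]
    [IsRiemannianManifold (𝓡∂ n) M] [MeasurableSpace M] [BorelSpace M]
    (p : ℝ) (hp : 1 < p) (φ : M → ℝ)
    (hφ : HardyManifold.IsFirstEigenfunction n p φ)
    (hφ_pos : ∀ x ∈ (𝓡∂ n).interior M, 0 < φ x)
    (hφ_grad : ∀ x ∈ (𝓡∂ n).boundary M, HardyManifold.grad n φ x ≠ 0) :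
    ∃ c : ℝ, 0 < c ∧ ∀ u : M → ℝ, HardyManifold.IsTest n ⊤ u →
      ENNReal.ofReal c *
          ∫⁻ x in (𝓡∂ n).interior M,
            ENNReal.ofReal (|u x| ^ p) / Metric.infEDist x ((𝓡∂ n).boundary M) ^ p
            ∂HardyManifold.riemannianVolume n ≤
        ∫⁻ x in (𝓡∂ n).interior M, ENNReal.ofReal (‖HardyManifold.grad n u x‖ ^ p)
          ∂HardyManifold.riemannianVolume n := by
  have hp0 : 0 < p := by linarith
  obtain ⟨hφ1, hφ_bd, lam, hpair, -⟩ := hφ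
  -- Without boundary the distance is `⊤`, so the left-hand side is `0` and any constant works.
  rcases ((𝓡∂ n).boundary M).eq_empty_or_nonempty with hempty | ⟨x₀, hx₀⟩
  · refine ⟨1, one_pos, fun u _ => ?_⟩
    simp [hempty, Metric.infEDist_empty, ENNReal.top_rpow_of_pos hp0]
  have hlam : 0 < lam := hpair.pos n hp hφ1 (hφ_grad x₀ hx₀)
  have hcases : ∀ x : M, x ∈ (𝓡∂ n).interior M ∨ x ∈ (𝓡∂ n).boundary M := fun x =>
    (𝓡∂ n).isInteriorPoint_or_isBoundaryPoint x
  have hφ0 : ∀ x, 0 ≤ φ x := fun x =>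
    (hcases x).elim (fun h => (hφ_pos x h).le) fun h => (hφ_bd x h).ge
  have hac := HardyManifold.continuous_norm_grad n hφ1
  -- the weight in the estimate is bounded below
  obtain ⟨m, hm0, hm⟩ : ∃ m : ℝ, 0 < m ∧ ∀ x, m ≤ (p - 1) / 2 * ‖HardyManifold.grad n φ x‖ ^ p +
      lam * φ x ^ p := by
    have hc : Continuous fun x => (p - 1) / 2 * ‖HardyManifold.grad n φ x‖ ^ p + lam * φ x ^ p :=
      ((hac.rpow_const fun _ => Or.inr hp0.le).const_mul _).add
        ((hφ1.continuous.rpow_const fun _ => Or.inr hp0.le).const_mul lam)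
    obtain ⟨z, -, hz⟩ := isCompact_univ.exists_isMinOn ⟨x₀, Set.mem_univ x₀⟩ hc.continuousOn
    refine ⟨_, ?_, fun x => hz (Set.mem_univ x)⟩
    have hp1 : 0 < (p - 1) / 2 := by linarith
    rcases hcases z with h | h
    · exact add_pos_of_nonneg_of_pos (by positivity)
        (mul_pos hlam (Real.rpow_pos_of_pos (hφ_pos z h) p))
    · exact add_pos_of_pos_of_nonneg
        (mul_pos hp1 (Real.rpow_pos_of_pos (norm_pos_iff.2 (hφ_grad z h)) p))
        (mul_nonneg hlam.le (Real.rpow_nonneg (hφ0 z) p))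
  -- the eigenfunction is dominated by the distance to the boundary
  obtain ⟨K, hK0, hK⟩ : ∃ K : ℝ, 0 < K ∧ ∀ x, ‖HardyManifold.grad n φ x‖ ≤ K := by
    obtain ⟨K, hK⟩ := (isCompact_univ.image hac).isBounded.exists_norm_le
    refine ⟨|K| + 1, by positivity, fun x => ?_⟩
    have := hK _ ⟨x, Set.mem_univ x, rfl⟩
    rw [norm_norm] at this
    linarith [le_abs_self K]
  have hdist : ∀ x, ENNReal.ofReal (φ x) ≤
      ENNReal.ofReal K * Metric.infEDist x ((𝓡∂ n).boundary M) := by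
    intro x
    have hK' : ENNReal.ofReal K ≠ 0 := by simpa using hK0
    rw [mul_comm, ← ENNReal.div_le_iff hK' ENNReal.ofReal_ne_top, Metric.le_infEDist]
    intro y hy
    rw [ENNReal.div_le_iff hK' ENNReal.ofReal_ne_top, mul_comm,
      IsRiemannianManifold.out (I := 𝓡∂ n) x y]
    have h := HardyManifold.enorm_sub_le_mul_riemannianEDist n hφ1 hK hK0 x y
    rwa [hφ_bd y hy, sub_zero, Real.enorm_of_nonneg (hφ0 x)] at h
  set C := p * ((p - 1) / (2 * p)) ^ (1 - p) with hC
  have hC0 : 0 < C :=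
    mul_pos hp0 (Real.rpow_pos_of_pos (div_pos (by linarith) (by linarith)) _)
  -- `K^p` pays for passing from `u / d` to `h`, and `C / m` for bounding `∫ |h|^p` by `∫ |∇u|^p`.
  refine ⟨m / (C * K ^ p), by positivity, fun u hu => ?_⟩
  have hu1 : HardyManifold.IsTest n 1 u := hu.one n
  set h : M → ℝ := fun x => u x / φ x with hh
  have hht : HardyManifold.IsTest n 1 h := hu1.div n hφ1 hφ_pos
  have huh : ∀ x, u x = h x * φ x := by
    intro x
    rcases hcases x with hx | hx
    · exact (div_mul_cancel₀ _ (hφ_pos x hx).ne').symm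
    -- On the boundary `φ` vanishes, and the identity survives because `u` is supported in the
    -- interior.
    · have : u x = 0 := image_eq_zero_of_notMem_tsupport fun hxu =>
        Set.disjoint_left.1 (𝓡∂ n).disjoint_interior_boundary (hu.2.2 hxu) hx
      simp [hh, this]
  have hpic := hpair.picone n hp hφ1 hφ0 hu1.1 hht huh
  have hhc : Continuous fun x => |h x| ^ p :=
    hht.1.continuous.abs.rpow_const fun _ => Or.inr hp0.le
  have hI := HardyManifold.integrable_interior_of_continuous n hhc
  have hIu := HardyManifold.integrable_interior_of_continuous n
    ((HardyManifold.continuous_norm_grad n hu1.1).rpow_const (p := p) fun _ => Or.inr hp0.le)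
  have hIw := HardyManifold.integrable_interior_of_continuous n (M := M)
    (hhc.mul (((hac.rpow_const (p := p) fun _ => Or.inr hp0.le).const_mul ((p - 1) / 2)).add
      ((hφ1.continuous.rpow_const (p := p) fun _ => Or.inr hp0.le).const_mul lam)))
  have hmain : m * ∫ x in (𝓡∂ n).interior M, |h x| ^ p ∂HardyManifold.riemannianVolume n ≤
      C * ∫ x in (𝓡∂ n).interior M, ‖HardyManifold.grad n u x‖ ^ p
        ∂HardyManifold.riemannianVolume n := by
    refine le_trans ?_ hpic
    rw [← integral_const_mul]
    refine integral_mono (hI.const_mul m) hIw fun x => ?_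
    rw [mul_comm]
    exact mul_le_mul_of_nonneg_left (hm x) (Real.rpow_nonneg (abs_nonneg _) p)
  have hpt : ∀ x, ENNReal.ofReal (|u x| ^ p) / Metric.infEDist x ((𝓡∂ n).boundary M) ^ p ≤
      ENNReal.ofReal (K ^ p * |h x| ^ p) := by
    intro x
    refine ENNReal.div_le_of_le_mul ?_
    rw [huh, abs_mul, Real.mul_rpow (abs_nonneg _) (abs_nonneg _), abs_of_nonneg (hφ0 x),
      mul_comm (K ^ p), ENNReal.ofReal_mul (by positivity), ENNReal.ofReal_mul (by positivity),
      ← ENNReal.ofReal_rpow_of_nonneg (hφ0 x) hp0.le, ← ENNReal.ofReal_rpow_of_nonneg hK0.le hp0.le,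
      mul_assoc, ← ENNReal.mul_rpow_of_nonneg _ _ hp0.le]
    gcongr
    exact hdist x
  calc _ ≤ ENNReal.ofReal (m / (C * K ^ p)) * ∫⁻ x in (𝓡∂ n).interior M,
        ENNReal.ofReal (K ^ p * |h x| ^ p) ∂HardyManifold.riemannianVolume n := by
        gcongr with x
        exact hpt x
    _ = ENNReal.ofReal (m / (C * K ^ p) * (K ^ p * ∫ x in (𝓡∂ n).interior M, |h x| ^ p
          ∂HardyManifold.riemannianVolume n)) := by
        rw [← ofReal_integral_eq_lintegral_ofReal (hI.const_mul _)
          (ae_of_all _ fun x => by positivity), integral_const_mul,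
          ← ENNReal.ofReal_mul (by positivity)]
    _ ≤ ENNReal.ofReal (∫ x in (𝓡∂ n).interior M, ‖HardyManifold.grad n u x‖ ^ p
          ∂HardyManifold.riemannianVolume n) := by
        refine ENNReal.ofReal_le_ofReal ?_
        have hKp : 0 < K ^ p := Real.rpow_pos_of_pos hK0 p
        rw [← mul_assoc, show m / (C * K ^ p) * K ^ p = m / C by field_simp, div_mul_eq_mul_div,
          div_le_iff₀' hC0]
        exact hmain
    _ = _ := ofReal_integral_eq_lintegral_ofReal hIu
        (ae_of_all _ fun x => Real.rpow_nonneg (norm_nonneg _) p)
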